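/- Let $R$ be a Gorenstein local ring of dimension $n$ with maximal ideal $\mathfrak m$, write $(-)^*=\operatorname{Hom}_R(-,R)$, let $r\ge 2$ and $0\le d\le n-r-1$, and let $J_0,\dots,J_d\subset R$ be Gorenstein ideals of grade $n$ (so that each $M_i=R/J_i$ is a Gorenstein local ring). For each $i$ let $(F^{(i)}_\bullet,\partial^{(i)}_\bullet)$ be a minimal free resolution of $M_i$ by finitely generated free modules. Put $\Omega_0(M_i)=M_i$ and $\Omega_k(M_i)=\operatorname{Im}(\partial^{(i)}_k)\subset F^{(i)}_{k-1}$ for $k\ge 1$. Write $\partial^{(i)}_k:F^{(i)}_k\to\Omega_k(M_i)$ also for the resulting surjection (the augmentation if $k=0$), and $\partial_k^*:\Omega_k(M_i)^*\to (F_k^{(i)})^*$, $\alpha\mapsto\alpha\circ\partial^{(i)}_k$, for its transpose. Let $$M=\bigoplus_{i=0}^d\Omega_i(M_i),\qquad U=\bigoplus_{i=0}^d F_i^{(i)},\qquad \varepsilon=\bigoplus_{i=0}^d\partial_i^{(i)}:U\to M .$$ Let $(\{\beta_1,\dots,\beta_q\},\varphi)$ be a b-sequence for $M$ with respect to the presentation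 $\varepsilon$. That is, for some injective homomorphism $f:F\to G$ of $R$-modules, with $G$ free with a basis $m_1,\dots,m_q$, we have $\beta_j\in U\setminus\operatorname{Ker}\varepsilon$ for all $j$, $\varphi\in U^*$ and $\operatorname{Ker}\varphi=\langle\beta_1,\dots,\beta_q\rangle+\operatorname{Ker}\varepsilon$, and the homomorphism $\beta:G\to U$ with $\beta(m_j)=\beta_j$ is such that $f$ maps $\operatorname{Ker}(\beta\circ f)$ onto $\operatorname{Ker}\beta$ and $\operatorname{Im}(\beta\circ f)=\langle\beta_1,\dots,\beta_q\rangle\cap\operatorname{Ker}\varepsilon$. Then there are $a_i\in\Omega_i(M_i)^*$ $(0\le i\le d)$ such that $$\varphi=\bigoplus_{i=0}^d a_i\circ\partial_i^{(i)},$$ so that the $i$-th component $a_i\circ\partial_i^{(i)}=\partial_i^*(a_i)$ of $\varphi$ lies in $\partial_i^*(\Omega_i(M_i)^*)\subset (F_i^{(i)})^*$; moreover, for $1\le i\le d$, the form $a_i$ is the restriction to $\Omega_i(M_i)\subset F_{i-1}^{(i)}$ of a linear form on $F_{i-1}^{(i)}$, so that this component also lies in the image of the transposed differential $(F_{i-1}^{(i)})^*\to(F_i^{(i)})^*$.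 -/

import Mathlib

universe u v w

/-- A Gorenstein local ring: a Noetherian local ring of finite injective dimension over itself. -/
class IsGorensteinLocalRing (R : Type u) [CommRing R] : Prop extends
    IsLocalRing R, IsNoetherianRing R where
  finite_injectiveDimension :
    ∃ k : ℕ, CategoryTheory.HasInjectiveDimensionLE (ModuleCat.of R R) k

/-- The grade of an ideal `J`: the supremum of the lengths of the `R`-regular sequences
contained in `J`. -/
noncomputable def idealGrade {R : Type u} [CommRing R] (J : Ideal R) : ℕ∞ :=
  ⨆ (rs : List R) (_ : RingTheory.Sequence.IsRegular R rs ∧ ∀ x ∈ rs, x ∈ J),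
    (rs.length : ℕ∞)

/-- A Gorenstein ideal of grade `n`: an ideal of grade `n` whose quotient ring is a Gorenstein
local ring (in particular the ideal is proper). -/
structure IsGorensteinIdeal {R : Type u} [CommRing R] (J : Ideal R) (n : ℕ) : Prop where
  quotient : IsGorensteinLocalRing (R ⧸ J)
  grade_eq : idealGrade J = n

/-- A minimal free resolution
`⋯ ⟶ X 2 ⟶ X 1 ⟶ X 0 ⟶ N ⟶ 0` of a module over a local ring, by finitely generated free modules,
where `d k : X (k + 1) ⟶ X k`; it is minimal when every differential has image in `𝔪 (X k)`. -/
structure MinimalFreeResolution (R : Type u) [CommRing R] [IsLocalRing R]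
    (N : Type u) [AddCommGroup N] [Module R N] where
  X : ℕ → ModuleCat.{u} R
  free : ∀ k, Module.Free R (X k)
  finite : ∀ k, Module.Finite R (X k)
  d : ∀ k, X (k + 1) →ₗ[R] X k
  aug : X 0 →ₗ[R] N
  aug_surjective : Function.Surjective aug
  exact_zero : Function.Exact (d 0) aug
  exact_succ : ∀ k, Function.Exact (d (k + 1)) (d k)
  minimal : ∀ k, LinearMap.range (d k) ≤
    IsLocalRing.maximalIdeal R • (⊤ : Submodule R (X k))

namespace MinimalFreeResolution

variable {R : Type u} [CommRing R] [IsLocalRing R]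
  {N : Type u} [AddCommGroup N] [Module R N]

/-- The `i`-th syzygy module `Ω_i(N)`: the module `N` itself for `i = 0`, and the image of
`∂_i : X i ⟶ X (i - 1)` for `i ≥ 1`. -/
def syzygy (P : MinimalFreeResolution R N) : ℕ → ModuleCat.{u} R
  | 0 => ModuleCat.of R N
  | k + 1 => ModuleCat.of R (LinearMap.range (P.d k))

/-- The surjection `∂_i : X i ⟶ Ω_i(N)`: the augmentation for `i = 0`, and the differential
corestricted to its image for `i ≥ 1`. -/
def cover (P : MinimalFreeResolution R N) : ∀ i : ℕ, P.X i →ₗ[R] P.syzygy i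
  | 0 => P.aug
  | k + 1 => (P.d k).rangeRestrict

/-- The inclusion of `Ω_{k+1}(N)` in `X k`. -/
def syzygyInclusion (P : MinimalFreeResolution R N) (k : ℕ) : P.syzygy (k + 1) →ₗ[R] P.X k :=
  (LinearMap.range (P.d k)).subtype

end MinimalFreeResolution

/-- `(β, φ)`, with `β = (β_1, …, β_q)` in `U` and `φ : U ⟶ R`, is a b-sequence for the pair
`(f : F ⟶ G, M)`, where `M` is presented by `ε : U ⟶ M`.

The field `diagram` is the commutative diagram with exact rows and columns of the definition:
`m` is a free basis of `G` and `B = m.constr R β : G ⟶ U` is the map with `B (m j) = β j`.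
Its top row says that `f` maps `ker (B ∘ f)` onto `ker B`, its left column that `B ∘ f` has image
`⟨β⟩ ∩ ker ε`; exactness at the other places is automatic from the injectivity of `f` and
from `range B = ⟨β⟩`. -/
structure IsBSequence {R : Type u} [CommRing R]
    {U M : Type u} [AddCommGroup U] [Module R U] [AddCommGroup M] [Module R M]
    {F : Type v} {G : Type w} [AddCommGroup F] [Module R F] [AddCommGroup G] [Module R G]
    (f : F →ₗ[R] G) (ε : U →ₗ[R] M) {q : ℕ} (β : Fin q → U) (φ : Module.Dual R U) : Prop where
  mono : Function.Injective f
  notMem_ker : ∀ j, β j ∉ LinearMap.ker ε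
  ker_eq : LinearMap.ker φ = Submodule.span R (Set.range β) ⊔ LinearMap.ker ε
  diagram : ∃ m : Module.Basis (Fin q) R G,
    (LinearMap.ker (m.constr R β ∘ₗ f)).map f = LinearMap.ker (m.constr R β) ∧
    LinearMap.range (m.constr R β ∘ₗ f) =
      Submodule.span R (Set.range β) ⊓ LinearMap.ker ε

/-!
Since `Ker φ` contains `Ker ε` and `ε` is surjective, `φ` factors through `ε`, which gives the forms
`a i`. That `a i`, for `i ≥ 1`, extends from the syzygy `Ω_i(R ⧸ J i)` to the free module around it
is the vanishing of `Ext^i(R ⧸ J i, R)`, which holds because `i` is less than the grade of `J i`.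

The vanishing is proved on cochains of the resolution `X`, for coefficients in any module `A` with a
weakly `A`-regular sequence `x :: rs` of elements annihilating the resolved module. Multiplication
by `x` is null-homotopic on `X` (`MinimalFreeResolution.exists_homotopy`), so `x • α` is a coboundary
`γ ∘ d` for each cocycle `α`. The reduction of `γ` modulo `x` is a cocycle with values in `A ⧸ x A`, in
degree one less, hence by induction on the degree a coboundary; lifting it back to `A` shows that
`γ` may be taken divisible by `x`, and `x` can be cancelled
(`MinimalFreeResolution.exists_eq_comp_d`).
-/

namespace MinimalFreeResolution

open scoped Pointwise

variable {R : Type u} [CommRing R] [IsLocalRing R]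
  {N : Type u} [AddCommGroup N] [Module R N] (P : MinimalFreeResolution R N)

theorem cover_surjective (i : ℕ) : Function.Surjective (P.cover i) := by
  cases i with
  | zero => exact P.aug_surjective
  | succ k => exact (P.d k).surjective_rangeRestrict

/-- A map from a free module of a resolution into the kernel of `g` lifts along `h` whenever
`h` and `g` are exact. -/
theorem exists_lift_of_exact (k : ℕ) {A B C : Type u} [AddCommGroup A] [Module R A]
    [AddCommGroup B] [Module R B] [AddCommGroup C] [Module R C]
    {h : A →ₗ[R] B} {g : B →ₗ[R] C} (hg : Function.Exact h g)
    (t : P.X k →ₗ[R] B) (ht : ∀ v, g (t v) = 0) : ∃ s : P.X k →ₗ[R] A, h ∘ₗ s = t := by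
  have := P.free k
  obtain ⟨s, hs⟩ := Module.projective_lifting_property h.rangeRestrict
    (t.codRestrict (LinearMap.range h) fun v => (hg _).1 (ht v)) h.surjective_rangeRestrict
  refine ⟨s, LinearMap.ext fun v => ?_⟩
  exact congrArg Subtype.val (LinearMap.congr_fun hs v)

/-- Multiplication by an element annihilating the resolved module is null-homotopic on the
resolution. -/
theorem exists_homotopy {x : R} (hx : ∀ y : N, x • y = 0) (k : ℕ) :
    ∃ (h : P.X k →ₗ[R] P.X (k + 1)) (h' : P.X (k + 1) →ₗ[R] P.X (k + 2)),
      ∀ v, x • v = P.d (k + 1) (h' v) + h (P.d k v) := by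
  have step : ∀ (j : ℕ) (h : P.X j →ₗ[R] P.X (j + 1)),
      (∀ w, P.d j (h (P.d j w)) = x • P.d j w) →
      ∃ h' : P.X (j + 1) →ₗ[R] P.X (j + 2), ∀ v, x • v = P.d (j + 1) (h' v) + h (P.d j v) := by
    intro j h hh
    obtain ⟨h', hh'⟩ := P.exists_lift_of_exact (j + 1) (P.exact_succ j)
      (x • LinearMap.id - h ∘ₗ P.d j) (fun v => by simp [hh])
    refine ⟨h', fun v => ?_⟩
    have := LinearMap.congr_fun hh' v
    simp only [LinearMap.comp_apply, LinearMap.sub_apply, LinearMap.smul_apply,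
      LinearMap.id_apply] at this
    rw [this, sub_add_cancel]
  induction k with
  | zero =>
    obtain ⟨h, hh⟩ := P.exists_lift_of_exact 0 P.exact_zero (x • LinearMap.id)
      (fun v => by simp [hx])
    exact ⟨h, step 0 h fun w => LinearMap.congr_fun hh _⟩
  | succ k ih =>
    obtain ⟨h, h', hh⟩ := ih
    refine ⟨h', step (k + 1) h' fun w => ?_⟩
    rw [hh (P.d (k + 1) w), (P.exact_succ k).apply_apply_eq_zero, map_zero, add_zero]

/-- Over a module `A` on which some annihilator of the resolved module is regular, there are no
nonzero cocycles in degree zero. -/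
theorem eq_zero_of_comp_d_zero {A : Type u} [AddCommGroup A] [Module R A] {x : R}
    (hx : ∀ y : N, x • y = 0) (hreg : IsSMulRegular A x) (α : P.X 0 →ₗ[R] A)
    (hα : α ∘ₗ P.d 0 = 0) : α = 0 := by
  refine LinearMap.ext fun v => hreg ?_
  obtain ⟨w, hw⟩ := (P.exact_zero (x • v)).1 (by rw [map_smul, hx])
  have : α (P.d 0 w) = 0 := LinearMap.congr_fun hα w
  simpa [hw] using this

/-- If a map `γ` into `A` becomes zero modulo `x`, it is divisible by `x`. -/
theorem exists_eq_smul_of_mkQ_comp_eq_zero (k : ℕ) {A : Type u} [AddCommGroup A] [Module R A]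
    {x : R} (γ : P.X k →ₗ[R] A)
    (hγ : (x • (⊤ : Submodule R A)).mkQ ∘ₗ γ = 0) : ∃ β : P.X k →ₗ[R] A, γ = x • β := by
  have hex : Function.Exact (LinearMap.lsmul R A x) (x • (⊤ : Submodule R A)).mkQ := by
    intro y
    simp [Submodule.mem_smul_pointwise_iff_exists]
  obtain ⟨β, hβ⟩ := P.exists_lift_of_exact k hex γ (LinearMap.congr_fun hγ)
  exact ⟨β, hβ.symm⟩

/-- The vanishing of `Ext^(k+1)(N, A)` when the annihilator of `N` contains a weakly `A`-regular
sequence of length greater than `k + 1`: every cocycle is a coboundary. -/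
theorem exists_eq_comp_d (k : ℕ) {A : Type u} [AddCommGroup A] [Module R A] (rs : List R)
    (hrs : RingTheory.Sequence.IsWeaklyRegular A rs) (hN : ∀ x ∈ rs, ∀ y : N, x • y = 0)
    (hlen : k + 1 < rs.length) (α : P.X (k + 1) →ₗ[R] A) (hα : α ∘ₗ P.d (k + 1) = 0) :
    ∃ β : P.X k →ₗ[R] A, α = β ∘ₗ P.d k := by
  induction k generalizing A rs with
  | zero =>
    obtain _ | ⟨x, _ | ⟨y, rs⟩⟩ := rs
    · simp at hlen
    · simp at hlen
    obtain ⟨hx, hrs⟩ := (RingTheory.Sequence.isWeaklyRegular_cons_iff _ _ _).1 hrs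
    obtain ⟨h, h', hh⟩ := P.exists_homotopy (hN x (by simp)) 0
    have hxα : ∀ v, x • α v = α (h (P.d 0 v)) := fun v => by
      have : α (P.d 1 (h' v)) = 0 := LinearMap.congr_fun hα _
      rw [← map_smul, hh, map_add, this, zero_add]
    have hγ : ((x • (⊤ : Submodule R A)).mkQ ∘ₗ α ∘ₗ h) ∘ₗ P.d 0 = 0 := by
      refine LinearMap.ext fun v => ?_
      simp only [LinearMap.comp_apply, ← hxα]
      exact (Submodule.Quotient.mk_eq_zero _).2
        (Submodule.smul_mem_pointwise_smul _ _ _ trivial)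
    obtain ⟨β, hβ⟩ := P.exists_eq_smul_of_mkQ_comp_eq_zero 0 (α ∘ₗ h)
      (P.eq_zero_of_comp_d_zero (hN y (by simp))
        ((RingTheory.Sequence.isWeaklyRegular_cons_iff _ _ _).1 hrs).1 _ hγ)
    refine ⟨β, LinearMap.ext fun v => hx ?_⟩
    exact (hxα v).trans (LinearMap.congr_fun hβ _)
  | succ k ih =>
    obtain _ | ⟨x, rs⟩ := rs
    · simp at hlen
    obtain ⟨hx, hrs⟩ := (RingTheory.Sequence.isWeaklyRegular_cons_iff _ _ _).1 hrs
    obtain ⟨h, h', hh⟩ := P.exists_homotopy (hN x (by simp)) (k + 1)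
    have hxα : ∀ v, x • α v = α (h (P.d (k + 1) v)) := fun v => by
      have : α (P.d (k + 2) (h' v)) = 0 := LinearMap.congr_fun hα _
      rw [← map_smul, hh, map_add, this, zero_add]
    have hγ : ((x • (⊤ : Submodule R A)).mkQ ∘ₗ α ∘ₗ h) ∘ₗ P.d (k + 1) = 0 := by
      refine LinearMap.ext fun v => ?_
      simp only [LinearMap.comp_apply, ← hxα]
      exact (Submodule.Quotient.mk_eq_zero _).2
        (Submodule.smul_mem_pointwise_smul _ _ _ trivial)
    obtain ⟨δ', hδ'⟩ := ih rs hrs (fun z hz => hN z (by simp [hz]))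
      (by simpa using hlen) _ hγ
    have := P.free k
    obtain ⟨δ, hδ⟩ := Module.projective_lifting_property (x • (⊤ : Submodule R A)).mkQ δ'
      (Submodule.mkQ_surjective _)
    obtain ⟨β, hβ⟩ := P.exists_eq_smul_of_mkQ_comp_eq_zero (k + 1) (α ∘ₗ h - δ ∘ₗ P.d k)
      (by rw [LinearMap.comp_sub, ← LinearMap.comp_assoc _ δ, hδ]; exact sub_eq_zero.2 hδ')
    refine ⟨β, LinearMap.ext fun v => hx ?_⟩
    have hv := LinearMap.congr_fun hβ (P.d (k + 1) v)
    simp only [LinearMap.sub_apply, LinearMap.comp_apply,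
      (P.exact_succ k).apply_apply_eq_zero, map_zero, sub_zero] at hv
    exact (hxα v).trans hv

/-- Linear forms on the syzygy `Ω_(k+1)(N)` extend to the free module `X k` when the annihilator
of `N` contains a regular sequence of length greater than `k + 1`. -/
theorem exists_eq_comp_syzygyInclusion (k : ℕ) (rs : List R)
    (hrs : RingTheory.Sequence.IsWeaklyRegular R rs) (hN : ∀ x ∈ rs, ∀ y : N, x • y = 0)
    (hlen : k + 1 < rs.length) (a : Module.Dual R (P.syzygy (k + 1))) :
    ∃ c : Module.Dual R (P.X k), a = c ∘ₗ P.syzygyInclusion k := by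
  obtain ⟨c, hc⟩ := P.exists_eq_comp_d k rs hrs hN hlen (a ∘ₗ P.cover (k + 1)) <| by
    refine LinearMap.ext fun v => ?_
    have : P.cover (k + 1) (P.d (k + 1) v) = 0 :=
      Subtype.ext ((P.exact_succ k).apply_apply_eq_zero v)
    simp [this]
  refine ⟨c, LinearMap.ext fun y => ?_⟩
  obtain ⟨v, rfl⟩ := P.cover_surjective (k + 1) y
  exact LinearMap.congr_fun hc v

end MinimalFreeResolution

theorem exists_isRegular_of_lt_idealGrade {R : Type u} [CommRing R] {J : Ideal R} {k : ℕ}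
    (hk : (k : ℕ∞) < idealGrade J) :
    ∃ rs : List R, RingTheory.Sequence.IsRegular R rs ∧ (∀ x ∈ rs, x ∈ J) ∧ k < rs.length := by
  obtain ⟨rs, hrs⟩ := lt_iSup_iff.1 hk
  obtain ⟨⟨hreg, hJ⟩, hlen⟩ := lt_iSup_iff.1 hrs
  exact ⟨rs, hreg, hJ, by exact_mod_cast hlen⟩

theorem proposition1p6 {R : Type u} [CommRing R] [IsGorensteinLocalRing R]
    (n r d : ℕ) (hdim : ringKrullDim R = n) (hr : 2 ≤ r) (hd : d + r + 1 ≤ n)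
    (J : Fin (d + 1) → Ideal R) (hJ : ∀ i, IsGorensteinIdeal (J i) n)
    (P : ∀ i : Fin (d + 1), MinimalFreeResolution R (R ⧸ J i))
    {F : Type v} {G : Type w} [AddCommGroup F] [Module R F] [AddCommGroup G] [Module R G]
    (f : F →ₗ[R] G) {q : ℕ}
    (β : Fin q → (∀ i : Fin (d + 1), (P i).X i))
    (φ : Module.Dual R (∀ i : Fin (d + 1), (P i).X i))
    (hβ : IsBSequence f (LinearMap.piMap fun i : Fin (d + 1) => (P i).cover i) β φ) :
    ∃ a : ∀ i : Fin (d + 1), Module.Dual R ((P i).syzygy i),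
      φ = ∑ i : Fin (d + 1), ((P i).cover i).dualMap (a i) ∘ₗ LinearMap.proj i ∧
      ∀ i : Fin d, ∃ c : Module.Dual R ((P i.succ).X i),
        a i.succ = c ∘ₗ (P i.succ).syzygyInclusion i := by
  have hsurj : Function.Surjective
      (LinearMap.piMap fun i : Fin (d + 1) => (P i).cover i) := fun y => by
    choose u hu using fun i => (P i).cover_surjective i (y i)
    exact ⟨u, funext hu⟩
  obtain ⟨a, ha⟩ : ∃ a : Module.Dual R (∀ i : Fin (d + 1), (P i).syzygy i),
      a ∘ₗ (LinearMap.piMap fun i : Fin (d + 1) => (P i).cover i) = φ := by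
    have hle : LinearMap.ker (LinearMap.piMap fun i : Fin (d + 1) => (P i).cover i) ≤
        LinearMap.ker φ := hβ.ker_eq ▸ le_sup_right
    refine ⟨(LinearMap.ker _).liftQ φ hle ∘ₗ
      (LinearMap.quotKerEquivOfSurjective _ hsurj).symm.toLinearMap, LinearMap.ext fun v => ?_⟩
    have : (LinearMap.quotKerEquivOfSurjective _ hsurj).symm
        (LinearMap.piMap (fun i : Fin (d + 1) => (P i).cover i) v) = Submodule.Quotient.mk v := by
      rw [LinearEquiv.symm_apply_eq]; rfl
    simp only [LinearMap.comp_apply, LinearEquiv.coe_coe, this]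
    rfl
  refine ⟨fun i => a ∘ₗ LinearMap.single R (fun i : Fin (d + 1) => (P i).syzygy i) i, ?_, fun i => ?_⟩
  · rw [← ha]
    refine LinearMap.pi_ext' fun j => LinearMap.ext fun v => ?_
    have hj : (LinearMap.piMap fun i : Fin (d + 1) => (P i).cover i) (Pi.single j v) =
        Pi.single j ((P j).cover j v) := by
      funext i
      obtain rfl | h := eq_or_ne i j <;> simp [*]
    simp only [LinearMap.comp_apply, LinearMap.single_apply, hj, LinearMap.sum_apply,
      LinearMap.dualMap_apply, LinearMap.proj_apply]
    rw [Finset.sum_eq_single j]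
    · simp
    · intro i _ h
      simp [h]
    · simp
  · have hlt : ((i + 1 : ℕ) : ℕ∞) < idealGrade (J i.succ) := by
      rw [(hJ i.succ).grade_eq]
      exact_mod_cast (by omega : (i : ℕ) + 1 < n)
    obtain ⟨rs, hreg, hrsJ, hlen⟩ := exists_isRegular_of_lt_idealGrade hlt
    refine (P i.succ).exists_eq_comp_syzygyInclusion i rs hreg.toIsWeaklyRegular
      (fun x hx y => ?_) hlen _
    obtain ⟨z, rfl⟩ := Ideal.Quotient.mk_surjective y
    exact Ideal.Quotient.eq_zero_iff_mem.2 (Ideal.mul_mem_right z _ (hrsJ x hx))
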